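/- Let $G$ be a finite connected vertex-weighted multigraph with vertex set $V$ and edge set $E$ (loops and parallel edges allowed) with a fixed orientation of each edge. For a choice of edge lengths $l(e)>0$, $e\in E$, let $\Gamma$ be the tropical curve with model $G$ and these lengths, i.e. the metric graph obtained by realizing each edge $e$ as the interval $[0,l(e)]$. Rational functions on $\Gamma$ are the continuous functions $f:\Gamma\to\mathbb{R}$ that are piecewise affine with integer slopes (finitely many pieces) on every edge; $(f)=\sum_p \mathrm{ord}_p(f)\,p$, where $\mathrm{ord}_p(f)$ is the sum of the outgoing slopes of $f$ at $p$; and for a divisor $D$ on $\Gamma$, $|D|=\{D'\ge 0 : D'=D+(f)\text{ for some rational function } f\}$, with the topology of the symmetric power of $\Gamma$. The linear system $|D|$ is decomposed into relatively open cells. The cell of $D'=D+(f)$ is labelled by the following discrete data: the coefficient $d_v$ of $D'$ at each $v\in V$; for each $e\in E$ the sequence $(d_{e,1},\dots,d_{e,r})$ of positive integers such that $D'$ is $\sum_j d_{e,j}x_j$ in the interior of $e$, with $0<x_1<\dots<x_r<l(e)$; and for each $e\in E$ the outgoing slope $m_e\in\mathbb{Z}$ of $f$ at the start of $e$. The combinatorial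 structure of $|D|$ consists of the set of labels of nonempty cells, of the face relation (a cell is contained in the closure of another cell), and of the dimension of every cell. **Lemma.** Let $D$ be a divisor supported on $V$. Then the combinatorial structure of $|D|$ does not depend on the length of any loop or bridge of $G$: if $\Gamma_1$ and $\Gamma_2$ are tropical curves with model $G$ whose edge lengths agree on every edge that is neither a loop nor a bridge, then $|D|$ on $\Gamma_1$ and $|D|$ on $\Gamma_2$ have the same (labels of) nonempty cells, the same face relation, and the same dimensions of cells. In particular this holds when $G$ is the minimal model of the curves. -/

import Mathlib

open Filter Topology

noncomputable section

/-- Two vertices are joined by a path that uses only edges of `S`, where the edge `e` has the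
end points `src e` and `tgt e`. -/
def JoinedBy {V E : Type*} (src tgt : E → V) (S : Set E) (v w : V) : Prop :=
  Relation.EqvGen (fun a b => ∃ e ∈ S, src e = a ∧ tgt e = b) v w

/-- A connected vertex-weighted multigraph (loops and parallel edges allowed), each edge carrying
a chosen orientation. -/
structure WeightedGraph (V E : Type*) where
  src : E → V
  tgt : E → V
  weight : V → ℕ
  nonempty : Nonempty V
  connected : ∀ v w : V, JoinedBy src tgt Set.univ v w

namespace WeightedGraph

variable {V E : Type*} (G : WeightedGraph V E)

def IsLoop (e : E) : Prop := G.src e = G.tgt e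

/-- Deleting `e` separates its two end points. -/
def IsBridge (e : E) : Prop := ¬ JoinedBy G.src G.tgt {e}ᶜ (G.src e) (G.tgt e)

end WeightedGraph

/-- A tropical curve with model `G`: the edge `e` is realized as the interval `[0, len e]`. -/
structure TropicalCurve {V E : Type*} (G : WeightedGraph V E) where
  len : E → ℝ
  len_pos : ∀ e, 0 < len e

/-- Discrete data of a cell: `mult v` is the number of points at the vertex `v`; `comp e` is the
list `(d₁, …, d_r)` of the multiplicities of the distinct points in the interior of `e`, in the
order of the orientation of `e`; `slope e` is the outgoing slope at the start of `e`. -/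
structure CellData (V E : Type*) where
  mult : V → ℕ
  comp : E → List ℕ+
  slope : E → ℤ

/-- A combinatorial structure of a polyhedral complex whose cells are labelled by `CellData V E`:
the set of (nonempty) cells, the relation "`τ` is a face of `σ`", and the dimensions. -/
@[ext]
structure CombinatorialStructure (V E : Type*) where
  cells : Set (CellData V E)
  IsFace : CellData V E → CellData V E → Prop
  dim : CellData V E → ℕ

/-- `g` is piecewise affine with integer slopes on `[0, l]`, with finitely many pieces. -/
def IsPiecewiseIntegralAffine (l : ℝ) (g : ℝ → ℝ) : Prop :=
  ∃ B : Finset ℝ, ∀ a b : ℝ, 0 ≤ a → a < b → b ≤ l → (∀ x ∈ B, x ∉ Set.Ioo a b) →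
    ∃ m : ℤ, ∀ x ∈ Set.Icc a b, g x = g a + m * (x - a)

/-- Near `x` on the right, `g` is affine with slope `m`. -/
def HasSlopeRight (g : ℝ → ℝ) (x : ℝ) (m : ℤ) : Prop :=
  ∀ᶠ y in 𝓝[>] x, g y = g x + m * (y - x)

/-- Near `x` on the left, `g` is affine with slope `-m`: the slope of `g` when one leaves `x` to
the left is `m`. -/
def HasSlopeLeft (g : ℝ → ℝ) (x : ℝ) (m : ℤ) : Prop :=
  ∀ᶠ y in 𝓝[<] x, g y = g x + m * (x - y)

/-- The slope of `g` when one leaves `x` to the right. -/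
def slopeRight (g : ℝ → ℝ) (x : ℝ) : ℤ := Classical.epsilon (HasSlopeRight g x)

/-- The slope of `g` when one leaves `x` to the left. -/
def slopeLeft (g : ℝ → ℝ) (x : ℝ) : ℤ := Classical.epsilon (HasSlopeLeft g x)

namespace TropicalCurve

variable {V E : Type*} {G : WeightedGraph V E} (Γ : TropicalCurve G)

/-- The points of the metric graph: the vertices, and the interior points of the edges. -/
inductive Point : Type _
  | vertex (v : V) : Point
  | inner (e : E) (x : Set.Ioo (0 : ℝ) (Γ.len e)) : Point

/-- The map `[0, len e] → Γ`, extended to the real line by its values at the end points. -/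
def edgePoint (e : E) (x : ℝ) : Γ.Point :=
  if h₀ : 0 < x then
    if h₁ : x < Γ.len e then Point.inner e ⟨x, h₀, h₁⟩ else Point.vertex (G.tgt e)
  else Point.vertex (G.src e)

/-- The quotient topology: a set is open iff its preimage in every closed edge is open. -/
instance : TopologicalSpace Γ.Point :=
  ⨆ e : E, TopologicalSpace.coinduced
    (fun x : Set.Icc (0 : ℝ) (Γ.len e) => Γ.edgePoint e x) inferInstance

/-- The group of divisors on `Γ`. -/
abbrev Div : Type _ := Γ.Point →₀ ℤ

/-- Rational functions. -/
def IsRational (f : Γ.Point → ℝ) : Prop :=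
  Continuous f ∧
    ∀ e : E, IsPiecewiseIntegralAffine (Γ.len e) (fun x => f (Γ.edgePoint e x))

open Classical in
/-- The order of `f` at a point: the sum of the outgoing slopes. A loop at `v` contributes with
both of its ends. -/
def ord [Fintype E] (f : Γ.Point → ℝ) : Γ.Point → ℤ
  | Point.vertex v =>
      (∑ e : E, if G.src e = v then slopeRight (fun t => f (Γ.edgePoint e t)) 0 else 0) +
      ∑ e : E, if G.tgt e = v then slopeLeft (fun t => f (Γ.edgePoint e t)) (Γ.len e) else 0
  | Point.inner e x =>
      slopeRight (fun t => f (Γ.edgePoint e t)) x + slopeLeft (fun t => f (Γ.edgePoint e t)) x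

/-- `D' = D + (f)` for the rational function `f`. -/
def IsEquivVia [Fintype E] (D D' : Γ.Div) (f : Γ.Point → ℝ) : Prop :=
  Γ.IsRational f ∧ ∀ p, D' p = D p + Γ.ord f p

/-- Effective divisors. -/
abbrev EffDiv : Type _ := {D : Γ.Div // 0 ≤ D}

/-- The effective divisor `p₁ + … + pₙ`. -/
def sumPoints (p : Σ n : ℕ, Fin n → Γ.Point) : Γ.EffDiv :=
  ⟨∑ i, Finsupp.single (p.2 i) 1,
    Finset.sum_nonneg fun _ _ => Finsupp.single_nonneg.2 zero_le_one⟩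

/-- The topology on effective divisors: the disjoint union of the symmetric powers `Γⁿ / Sₙ`. -/
instance : TopologicalSpace Γ.EffDiv :=
  TopologicalSpace.coinduced Γ.sumPoints inferInstance

/-- The linear system `|D|`. -/
def linearSystem [Fintype E] (D : Γ.Div) : Set Γ.EffDiv :=
  {D' | ∃ f, Γ.IsEquivVia D D'.1 f}

/-- `D' = D + (f)` lies in the open cell of `|D|` with data `σ`, and `x e 0 < x e 1 < …` are the
points of `D'` in the interior of the edge `e`. -/
def LiesInCell [Fintype E] (D : Γ.Div) (σ : CellData V E) (D' : Γ.EffDiv)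
    (x : (e : E) → Fin (σ.comp e).length → ℝ) : Prop :=
  (∃ f, Γ.IsEquivVia D D'.1 f ∧
    ∀ e, slopeRight (fun t => f (Γ.edgePoint e t)) 0 = σ.slope e) ∧
  (∀ v, D'.1 (Point.vertex v) = σ.mult v) ∧
  ∀ e, StrictMono (x e) ∧ (∀ j, x e j ∈ Set.Ioo (0 : ℝ) (Γ.len e)) ∧
    (∀ j, D'.1 (Γ.edgePoint e (x e j)) = (((σ.comp e).get j : ℕ) : ℤ)) ∧
    ∀ t ∈ Set.Ioo (0 : ℝ) (Γ.len e), (∀ j, t ≠ x e j) → D'.1 (Γ.edgePoint e t) = 0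

/-- The (relatively open, possibly empty) cell of `|D|` with data `σ`. -/
def cell [Fintype E] (D : Γ.Div) (σ : CellData V E) : Set Γ.EffDiv :=
  {D' | ∃ x, Γ.LiesInCell D σ D' x}

/-- The cell with data `σ` in its coordinates: a relatively open polytope in the space of the
tuples of positions of the points on the edges. -/
def cellCoords [Fintype E] (D : Γ.Div) (σ : CellData V E) :
    Set ((e : E) → Fin (σ.comp e).length → ℝ) :=
  {x | ∃ D', Γ.LiesInCell D σ D' x}

/-- The combinatorial structure of the polyhedral complex `|D|`: its nonempty cells, the
inclusions of cells in the closures of cells, and the dimensions of the cells. -/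
def combinatorialStructure [Fintype E] (D : Γ.Div) : CombinatorialStructure V E where
  cells := {σ | (Γ.cell D σ).Nonempty}
  IsFace τ σ := (Γ.cell D τ).Nonempty ∧ (Γ.cell D σ).Nonempty ∧
    Γ.cell D τ ⊆ closure (Γ.cell D σ)
  dim σ := Module.finrank ℝ (vectorSpan ℝ (Γ.cellCoords D σ))

/-- A divisor on the vertices of the model, as a divisor on `Γ`. -/
def ofVertices (D : V →₀ ℤ) : Γ.Div := D.mapDomain Point.vertex

end TropicalCurve

end

/-!
Stretching every edge linearly is a homeomorphism `Γ₁ → Γ₂` of curves with the same model, and it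
induces a homeomorphism between the spaces of effective divisors. The point is that it carries each
cell of `|D|` on `Γ₁` onto the cell of `|D|` on `Γ₂` with the same label.

Let `D' = D + (f)` on `Γ₁`, and let the edge `e` be stretched by the factor `r e`. On the edge `e` of
`Γ₂` take the function `a e + r e * f`, read at the corresponding point; it has the same slopes as
`f`, whatever the constant `a e` is. These functions glue to a rational function on `Γ₂` once vertex
values are found whose increment along every edge `e` is `r e` times that of `f`, that is, once the
increments `(r e - 1) * (f (tgt e) - f (src e))` come from a potential on the vertices
(`WeightedGraph.exists_potential`). Where `e` is neither a loop nor a bridge `r e = 1`, and on a loop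
the increment of `f` vanishes, so the increments are concentrated on bridges. There the potential is a
combination of the indicator functions of the far sides of the bridges.

Labels, closures and hence faces are preserved because cells are carried onto cells by a
homeomorphism; dimensions are preserved because, in coordinates, the stretching is an invertible
linear map.
-/

noncomputable section

/-! ### Slopes of rescaled functions -/

lemma HasSlopeRight.rescale {g₁ g₂ : ℝ → ℝ} {a r x : ℝ} {m : ℤ} (hr : 0 < r)
    (h : ∀ t, g₂ (t * r) = a + r * g₁ t) (hg : HasSlopeRight g₁ x m) :
    HasSlopeRight g₂ (x * r) m := by
  have ht : Tendsto (fun y : ℝ => y / r) (𝓝[>] (x * r)) (𝓝[>] x) := by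
    have hc : ContinuousWithinAt (fun y : ℝ => y / r) (Set.Ioi (x * r)) (x * r) := by fun_prop
    have := hc.tendsto_nhdsWithin (t := Set.Ioi x) fun y hy => (lt_div_iff₀ hr).2 hy
    rwa [mul_div_cancel_right₀ _ hr.ne'] at this
  filter_upwards [ht.eventually hg] with y hy
  have hy' := h (y / r)
  rw [div_mul_cancel₀ _ hr.ne', hy] at hy'
  rw [hy', h]
  field_simp
  ring

lemma HasSlopeLeft.rescale {g₁ g₂ : ℝ → ℝ} {a r x : ℝ} {m : ℤ} (hr : 0 < r)
    (h : ∀ t, g₂ (t * r) = a + r * g₁ t) (hg : HasSlopeLeft g₁ x m) :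
    HasSlopeLeft g₂ (x * r) m := by
  have ht : Tendsto (fun y : ℝ => y / r) (𝓝[<] (x * r)) (𝓝[<] x) := by
    have hc : ContinuousWithinAt (fun y : ℝ => y / r) (Set.Iio (x * r)) (x * r) := by fun_prop
    have := hc.tendsto_nhdsWithin (t := Set.Iio x) fun y hy => (div_lt_iff₀ hr).2 hy
    rwa [mul_div_cancel_right₀ _ hr.ne'] at this
  filter_upwards [ht.eventually hg] with y hy
  have hy' := h (y / r)
  rw [div_mul_cancel₀ _ hr.ne', hy] at hy'
  rw [hy', h]
  field_simp
  ring

lemma rescale_relation_symm {g₁ g₂ : ℝ → ℝ} {a r : ℝ} (hr : 0 < r)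
    (h : ∀ t, g₂ (t * r) = a + r * g₁ t) (t : ℝ) :
    g₁ (t * r⁻¹) = -(r⁻¹ * a) + r⁻¹ * g₂ t := by
  have := h (t * r⁻¹)
  rw [inv_mul_cancel_right₀ hr.ne'] at this
  rw [this]
  field_simp
  ring

/-- No uniqueness of slopes is needed: the predicates defining the two slopes coincide. -/
lemma slopeRight_rescale {g₁ g₂ : ℝ → ℝ} {a r : ℝ} (hr : 0 < r)
    (h : ∀ t, g₂ (t * r) = a + r * g₁ t) (x : ℝ) :
    slopeRight g₂ (x * r) = slopeRight g₁ x := by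
  have : HasSlopeRight g₂ (x * r) = HasSlopeRight g₁ x := by
    funext m
    refine propext ⟨fun hg => ?_, fun hg => hg.rescale hr h⟩
    have := hg.rescale (inv_pos.2 hr) (rescale_relation_symm hr h)
    rwa [mul_inv_cancel_right₀ hr.ne'] at this
  rw [slopeRight, slopeRight, this]

lemma slopeLeft_rescale {g₁ g₂ : ℝ → ℝ} {a r : ℝ} (hr : 0 < r)
    (h : ∀ t, g₂ (t * r) = a + r * g₁ t) (x : ℝ) :
    slopeLeft g₂ (x * r) = slopeLeft g₁ x := by
  have : HasSlopeLeft g₂ (x * r) = HasSlopeLeft g₁ x := by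
    funext m
    refine propext ⟨fun hg => ?_, fun hg => hg.rescale hr h⟩
    have := hg.rescale (inv_pos.2 hr) (rescale_relation_symm hr h)
    rwa [mul_inv_cancel_right₀ hr.ne'] at this
  rw [slopeLeft, slopeLeft, this]

lemma IsPiecewiseIntegralAffine.rescale {g₁ g₂ : ℝ → ℝ} {a r l : ℝ} (hr : 0 < r)
    (h : ∀ t, g₂ (t * r) = a + r * g₁ t) (hg : IsPiecewiseIntegralAffine l g₁) :
    IsPiecewiseIntegralAffine (l * r) g₂ := by
  classical
  obtain ⟨B, hB⟩ := hg
  refine ⟨B.image (· * r), fun b c hb hbc hc hBc => ?_⟩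
  obtain ⟨m, hm⟩ := hB (b / r) (c / r) (div_nonneg hb hr.le) (by gcongr)
    ((div_le_iff₀ hr).2 hc) fun x hx hx' => hBc (x * r) (Finset.mem_image_of_mem _ hx)
      ⟨(div_lt_iff₀ hr).1 hx'.1, (lt_div_iff₀ hr).1 hx'.2⟩
  refine ⟨m, fun x hx => ?_⟩
  have hx1 := h (x / r)
  have hb1 := h (b / r)
  rw [div_mul_cancel₀ _ hr.ne'] at hx1 hb1
  rw [hx1, hb1, hm (x / r) ⟨by gcongr; exact hx.1, by gcongr; exact hx.2⟩]
  field_simp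
  ring

/-! ### Potentials on the vertices -/

namespace WeightedGraph

variable {V E : Type*} (G : WeightedGraph V E)

/-- Increments along the edges that vanish outside the bridges come from a function on the vertices:
the sum over the bridges of the prescribed increment times the indicator function of the side of the
target. -/
lemma exists_potential [Fintype E] (w : E → ℝ) (hw : ∀ e, ¬ G.IsBridge e → w e = 0) :
    ∃ h : V → ℝ, ∀ e, h (G.tgt e) - h (G.src e) = w e := by
  classical
  let χ : E → V → ℝ := fun e v => if JoinedBy G.src G.tgt {e}ᶜ v (G.tgt e) then 1 else 0
  refine ⟨fun v => ∑ e, w e * χ e v, fun e => ?_⟩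
  rw [← Finset.sum_sub_distrib, Finset.sum_eq_single e]
  · by_cases hb : G.IsBridge e
    · have h1 : χ e (G.tgt e) = 1 := if_pos (Relation.EqvGen.refl _)
      have h0 : χ e (G.src e) = 0 := if_neg hb
      rw [h1, h0]
      ring
    · simp [hw e hb]
  · intro b _ hbe
    have hj : JoinedBy G.src G.tgt {b}ᶜ (G.src e) (G.tgt e) :=
      Relation.EqvGen.rel _ _ ⟨e, fun h => hbe h.symm, rfl, rfl⟩
    have : χ b (G.tgt e) = χ b (G.src e) :=
      if_congr ⟨fun h => hj.trans _ _ _ h, fun h => (hj.symm _ _).trans _ _ _ h⟩ rfl rfl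
    rw [this, sub_self]
  · simp

end WeightedGraph

namespace TropicalCurve

variable {V E : Type*} {G : WeightedGraph V E} (Γ Γ₁ Γ₂ : TropicalCurve G)

/-! ### The stretching homeomorphism -/

/-- The factor by which the edge `e` is stretched. -/
def ratio (e : E) : ℝ := Γ₂.len e / Γ₁.len e

lemma ratio_pos (e : E) : 0 < ratio Γ₁ Γ₂ e := div_pos (Γ₂.len_pos e) (Γ₁.len_pos e)

lemma len_mul_ratio (e : E) : Γ₁.len e * ratio Γ₁ Γ₂ e = Γ₂.len e :=
  mul_div_cancel₀ _ (Γ₁.len_pos e).ne'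

lemma mul_ratio_mul_ratio (e : E) (t : ℝ) : t * ratio Γ₁ Γ₂ e * ratio Γ₂ Γ₁ e = t := by
  have h₁ := (Γ₁.len_pos e).ne'
  have h₂ := (Γ₂.len_pos e).ne'
  rw [ratio, ratio]
  field_simp

lemma edgePoint_zero (e : E) : Γ.edgePoint e 0 = Point.vertex (G.src e) := by
  simp [edgePoint]

lemma edgePoint_len (e : E) : Γ.edgePoint e (Γ.len e) = Point.vertex (G.tgt e) := by
  simp [edgePoint, Γ.len_pos e]

lemma edgePoint_coe (e : E) (x : Set.Ioo (0 : ℝ) (Γ.len e)) :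
    Γ.edgePoint e x = Point.inner e x := by
  simp [edgePoint, x.2.1, x.2.2]

/-- The linear stretching of every edge. -/
def stretch : Γ₁.Point → Γ₂.Point
  | Point.vertex v => Point.vertex v
  | Point.inner e x => Γ₂.edgePoint e (x * ratio Γ₁ Γ₂ e)

lemma stretch_edgePoint (e : E) (t : ℝ) :
    stretch Γ₁ Γ₂ (Γ₁.edgePoint e t) = Γ₂.edgePoint e (t * ratio Γ₁ Γ₂ e) := by
  have hr := ratio_pos Γ₁ Γ₂ e
  have hl := len_mul_ratio Γ₁ Γ₂ e
  by_cases h₀ : 0 < t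
  · by_cases h₁ : t < Γ₁.len e
    · rw [edgePoint, dif_pos h₀, dif_pos h₁, stretch]
    · have h₁' : ¬ t * ratio Γ₁ Γ₂ e < Γ₂.len e := by
        rw [← hl, mul_lt_mul_iff_left₀ hr]; exact h₁
      rw [edgePoint, dif_pos h₀, dif_neg h₁, edgePoint, dif_pos (mul_pos h₀ hr), dif_neg h₁',
        stretch]
  · have h₀' : ¬ 0 < t * ratio Γ₁ Γ₂ e := by rwa [mul_pos_iff_of_pos_right hr]
    rw [edgePoint, dif_neg h₀, edgePoint, dif_neg h₀', stretch]

lemma stretch_stretch (p : Γ₁.Point) : stretch Γ₂ Γ₁ (stretch Γ₁ Γ₂ p) = p := by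
  cases p with
  | vertex v => rfl
  | inner e x =>
    rw [← edgePoint_coe, stretch_edgePoint, stretch_edgePoint, mul_ratio_mul_ratio]

lemma continuous_edgePoint (e : E) :
    Continuous fun x : Set.Icc (0 : ℝ) (Γ.len e) => Γ.edgePoint e x :=
  continuous_iff_coinduced_le.2 (le_iSup (fun e : E => TopologicalSpace.coinduced
    (fun x : Set.Icc (0 : ℝ) (Γ.len e) => Γ.edgePoint e x) inferInstance) e)

/-- The topology of the curve is final with respect to the edges. -/
lemma continuous_of_edges {X : Type*} [TopologicalSpace X] {f : Γ.Point → X}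
    (h : ∀ e, Continuous fun x : Set.Icc (0 : ℝ) (Γ.len e) => f (Γ.edgePoint e x)) :
    Continuous f :=
  continuous_iSup_dom.2 fun e => continuous_coinduced_dom.2 (h e)

/-- The stretching of the closed edge `e`. -/
def stretchIcc (e : E) (x : Set.Icc (0 : ℝ) (Γ₁.len e)) : Set.Icc (0 : ℝ) (Γ₂.len e) :=
  ⟨x * ratio Γ₁ Γ₂ e, mul_nonneg x.2.1 (ratio_pos Γ₁ Γ₂ e).le, by
    rw [← len_mul_ratio Γ₁ Γ₂ e]
    exact mul_le_mul_of_nonneg_right x.2.2 (ratio_pos Γ₁ Γ₂ e).le⟩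

lemma continuous_stretchIcc (e : E) : Continuous (stretchIcc Γ₁ Γ₂ e) :=
  (continuous_subtype_val.mul continuous_const).subtype_mk _

lemma continuous_stretch : Continuous (stretch Γ₁ Γ₂) := by
  refine continuous_of_edges Γ₁ fun e => ?_
  simp only [stretch_edgePoint]
  exact (continuous_edgePoint Γ₂ e).comp (continuous_stretchIcc Γ₁ Γ₂ e)

lemma stretch_injective : Function.Injective (stretch Γ₁ Γ₂) :=
  Function.LeftInverse.injective (stretch_stretch Γ₁ Γ₂)

/-! ### Stretching divisors -/

/-- The push-forward of effective divisors along the stretching. -/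
def stretchDiv (D : Γ₁.EffDiv) : Γ₂.EffDiv :=
  ⟨D.1.mapDomain (stretch Γ₁ Γ₂), fun p => by
    rw [← stretch_stretch Γ₂ Γ₁ p, Finsupp.mapDomain_apply (stretch_injective Γ₁ Γ₂)]
    exact D.2 _⟩

lemma stretchDiv_apply (D : Γ₁.EffDiv) (p : Γ₁.Point) :
    (stretchDiv Γ₁ Γ₂ D).1 (stretch Γ₁ Γ₂ p) = D.1 p :=
  Finsupp.mapDomain_apply (stretch_injective Γ₁ Γ₂) _ _

lemma stretchDiv_stretchDiv (D : Γ₁.EffDiv) : stretchDiv Γ₂ Γ₁ (stretchDiv Γ₁ Γ₂ D) = D := by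
  refine Subtype.ext (Finsupp.ext fun p => ?_)
  nth_rw 1 [← stretch_stretch Γ₁ Γ₂ p]
  rw [stretchDiv_apply, stretchDiv_apply]

lemma continuous_stretchDiv : Continuous (stretchDiv Γ₁ Γ₂) := by
  refine continuous_coinduced_dom.2 ?_
  have hcomp : stretchDiv Γ₁ Γ₂ ∘ Γ₁.sumPoints =
      Γ₂.sumPoints ∘ Sigma.map id fun _ p i => stretch Γ₁ Γ₂ (p i) := by
    funext p
    refine Subtype.ext ?_
    simp only [stretchDiv, sumPoints, Sigma.map, Function.comp_apply,
      Finsupp.mapDomain_finsetSum, Finsupp.mapDomain_single]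
    rfl
  rw [hcomp]
  refine continuous_coinduced_rng.comp (Continuous.sigma_map fun n => ?_)
  exact continuous_pi fun i => (continuous_stretch Γ₁ Γ₂).comp (continuous_apply i)

/-- The push-forward of effective divisors along the stretching, as a homeomorphism. -/
def stretchHomeo : Γ₁.EffDiv ≃ₜ Γ₂.EffDiv where
  toFun := stretchDiv Γ₁ Γ₂
  invFun := stretchDiv Γ₂ Γ₁
  left_inv := stretchDiv_stretchDiv Γ₁ Γ₂
  right_inv := stretchDiv_stretchDiv Γ₂ Γ₁
  continuous_toFun := continuous_stretchDiv Γ₁ Γ₂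
  continuous_invFun := continuous_stretchDiv Γ₂ Γ₁

lemma ofVertices_stretch (D : V →₀ ℤ) (p : Γ₁.Point) :
    Γ₂.ofVertices D (stretch Γ₁ Γ₂ p) = Γ₁.ofVertices D p := by
  have : Γ₂.ofVertices D = (Γ₁.ofVertices D).mapDomain (stretch Γ₁ Γ₂) := by
    rw [ofVertices, ofVertices, ← Finsupp.mapDomain_comp]
    rfl
  rw [this, Finsupp.mapDomain_apply (stretch_injective Γ₁ Γ₂)]

/-! ### Stretching rational functions -/

section Functions

variable {Γ₁ Γ₂} {f : Γ₁.Point → ℝ} {g : Γ₂.Point → ℝ} {a : E → ℝ}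

lemma IsRational.stretch
    (h : ∀ e t, g (Γ₂.edgePoint e (t * ratio Γ₁ Γ₂ e)) =
      a e + ratio Γ₁ Γ₂ e * f (Γ₁.edgePoint e t))
    (hf : Γ₁.IsRational f) : Γ₂.IsRational g := by
  refine ⟨continuous_of_edges Γ₂ fun e => ?_, fun e => ?_⟩
  · have heq : (fun x : Set.Icc (0 : ℝ) (Γ₂.len e) => g (Γ₂.edgePoint e x)) =
        fun x => a e + ratio Γ₁ Γ₂ e * f (Γ₁.edgePoint e (stretchIcc Γ₂ Γ₁ e x)) := by
      funext x
      rw [← h, stretchIcc, mul_ratio_mul_ratio]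
    rw [heq]
    exact continuous_const.add (continuous_const.mul
      (hf.1.comp ((continuous_edgePoint Γ₁ e).comp (continuous_stretchIcc Γ₂ Γ₁ e))))
  · rw [← len_mul_ratio Γ₁ Γ₂ e]
    exact (hf.2 e).rescale (ratio_pos Γ₁ Γ₂ e) (h e)

lemma ord_stretch [Fintype E]
    (h : ∀ e t, g (Γ₂.edgePoint e (t * ratio Γ₁ Γ₂ e)) =
      a e + ratio Γ₁ Γ₂ e * f (Γ₁.edgePoint e t)) (p : Γ₁.Point) :
    Γ₂.ord g (stretch Γ₁ Γ₂ p) = Γ₁.ord f p := by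
  have hR := fun e => slopeRight_rescale (g₁ := fun t => f (Γ₁.edgePoint e t))
    (g₂ := fun t => g (Γ₂.edgePoint e t)) (ratio_pos Γ₁ Γ₂ e) (h e)
  have hL := fun e => slopeLeft_rescale (g₁ := fun t => f (Γ₁.edgePoint e t))
    (g₂ := fun t => g (Γ₂.edgePoint e t)) (ratio_pos Γ₁ Γ₂ e) (h e)
  cases p with
  | vertex v =>
    have hR0 := fun e => hR e 0
    have hL1 := fun e => hL e (Γ₁.len e)
    simp only [zero_mul, len_mul_ratio] at hR0 hL1
    simp only [TropicalCurve.stretch, ord, hR0, hL1]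
  | inner e x =>
    have hx : (x : ℝ) * ratio Γ₁ Γ₂ e ∈ Set.Ioo (0 : ℝ) (Γ₂.len e) :=
      ⟨mul_pos x.2.1 (ratio_pos Γ₁ Γ₂ e), by
        rw [← len_mul_ratio Γ₁ Γ₂ e]
        exact mul_lt_mul_of_pos_right x.2.2 (ratio_pos Γ₁ Γ₂ e)⟩
    have hs : TropicalCurve.stretch Γ₁ Γ₂ (Point.inner e x) = Point.inner e ⟨_, hx⟩ :=
      edgePoint_coe Γ₂ e ⟨_, hx⟩
    rw [hs]
    simp only [ord, hR, hL]

/-- Every real function on `Γ₁` can be stretched, up to a constant on each edge, if only loops and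
bridges change their lengths. -/
lemma exists_stretched_function [Fintype E]
    (hlen : ∀ e, ¬ G.IsLoop e → ¬ G.IsBridge e → Γ₁.len e = Γ₂.len e) (f : Γ₁.Point → ℝ) :
    ∃ (g : Γ₂.Point → ℝ) (a : E → ℝ), ∀ e t, g (Γ₂.edgePoint e (t * ratio Γ₁ Γ₂ e)) =
      a e + ratio Γ₁ Γ₂ e * f (Γ₁.edgePoint e t) := by
  obtain ⟨h, hh⟩ := G.exists_potential (fun e => (ratio Γ₁ Γ₂ e - 1) *
    (f (Point.vertex (G.tgt e)) - f (Point.vertex (G.src e)))) fun e hb => by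
      by_cases hl : G.IsLoop e
      · rw [show G.tgt e = G.src e from Eq.symm hl, sub_self, mul_zero]
      · rw [ratio, hlen e hl hb, div_self (Γ₂.len_pos e).ne', sub_self, zero_mul]
  let a : E → ℝ := fun e => f (Point.vertex (G.src e)) + h (G.src e) -
    ratio Γ₁ Γ₂ e * f (Point.vertex (G.src e))
  let g : Γ₂.Point → ℝ := fun p => match p with
    | Point.vertex v => f (Point.vertex v) + h v
    | Point.inner e x => a e + ratio Γ₁ Γ₂ e * f (TropicalCurve.stretch Γ₂ Γ₁ (Point.inner e x))
  refine ⟨g, a, fun e t => ?_⟩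
  have key : ∀ t, g (Γ₂.edgePoint e t) =
      a e + ratio Γ₁ Γ₂ e * f (TropicalCurve.stretch Γ₂ Γ₁ (Γ₂.edgePoint e t)) := by
    intro t
    rw [edgePoint]
    split_ifs
    · rfl
    · have := hh e
      simp only [g, a, TropicalCurve.stretch]
      linarith
    · simp only [g, a, TropicalCurve.stretch]
      ring
  rw [key, stretch_edgePoint, mul_ratio_mul_ratio]

end Functions

/-! ### Cells -/

/-- The stretching of the coordinates of the points on the edges. -/
def stretchCoords (ι : E → Type*) : ((e : E) → ι e → ℝ) ≃ₗ[ℝ] ((e : E) → ι e → ℝ) where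
  toFun x e j := x e j * ratio Γ₁ Γ₂ e
  invFun x e j := x e j * ratio Γ₂ Γ₁ e
  map_add' x y := by ext; simp [add_mul]
  map_smul' c x := by ext; simp [mul_assoc]
  left_inv x := by ext; simp [mul_ratio_mul_ratio]
  right_inv x := by ext; simp [mul_ratio_mul_ratio]

variable {Γ₁ Γ₂} [Fintype E] {D : V →₀ ℤ} {σ : CellData V E}

lemma LiesInCell.stretch
    (hlen : ∀ e, ¬ G.IsLoop e → ¬ G.IsBridge e → Γ₁.len e = Γ₂.len e)
    {D' : Γ₁.EffDiv} {x : (e : E) → Fin (σ.comp e).length → ℝ}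
    (h : Γ₁.LiesInCell (Γ₁.ofVertices D) σ D' x) :
    Γ₂.LiesInCell (Γ₂.ofVertices D) σ (stretchDiv Γ₁ Γ₂ D') (stretchCoords Γ₁ Γ₂ _ x) := by
  obtain ⟨⟨f, ⟨hf, hD'⟩, hslope⟩, hmult, hedge⟩ := h
  obtain ⟨g, a, hg⟩ := exists_stretched_function hlen f
  refine ⟨⟨g, ⟨hf.stretch hg, fun p => ?_⟩, fun e => ?_⟩, fun v => ?_, fun e => ?_⟩
  · rw [← stretch_stretch Γ₂ Γ₁ p, stretchDiv_apply, ofVertices_stretch, ord_stretch hg, hD']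
  · have := slopeRight_rescale (g₁ := fun t => f (Γ₁.edgePoint e t))
      (g₂ := fun t => g (Γ₂.edgePoint e t)) (ratio_pos Γ₁ Γ₂ e) (hg e) 0
    rw [zero_mul] at this
    rw [this, hslope]
  · rw [← hmult]
    exact stretchDiv_apply Γ₁ Γ₂ D' (Point.vertex v)
  · have hr := ratio_pos Γ₁ Γ₂ e
    obtain ⟨hmono, hmem, hval, hzero⟩ := hedge e
    refine ⟨fun i j hij => mul_lt_mul_of_pos_right (hmono hij) hr, fun j => ⟨?_, ?_⟩,
      fun j => ?_, fun t ht hne => ?_⟩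
    · exact mul_pos (hmem j).1 hr
    · rw [← len_mul_ratio Γ₁ Γ₂ e]
      exact mul_lt_mul_of_pos_right (hmem j).2 hr
    · rw [← hval j, ← stretchDiv_apply Γ₁ Γ₂ D', stretch_edgePoint]
      rfl
    · have ht' : t * ratio Γ₂ Γ₁ e ∈ Set.Ioo (0 : ℝ) (Γ₁.len e) :=
        ⟨mul_pos ht.1 (ratio_pos Γ₂ Γ₁ e), by
          rw [← len_mul_ratio Γ₂ Γ₁ e]
          exact mul_lt_mul_of_pos_right ht.2 (ratio_pos Γ₂ Γ₁ e)⟩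
      rw [← hzero _ ht' fun j hj => hne j ?_, ← stretchDiv_apply Γ₁ Γ₂ D', stretch_edgePoint,
        mul_ratio_mul_ratio]
      rw [← mul_ratio_mul_ratio Γ₂ Γ₁ e t, hj]
      rfl

variable (D σ)

lemma image_cell (hlen : ∀ e, ¬ G.IsLoop e → ¬ G.IsBridge e → Γ₁.len e = Γ₂.len e) :
    stretchHomeo Γ₁ Γ₂ '' Γ₁.cell (Γ₁.ofVertices D) σ = Γ₂.cell (Γ₂.ofVertices D) σ := by
  refine Set.Subset.antisymm ?_ ?_
  · rintro _ ⟨D', ⟨x, hx⟩, rfl⟩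
    exact ⟨_, hx.stretch hlen⟩
  · rintro D' ⟨x, hx⟩
    exact ⟨stretchDiv Γ₂ Γ₁ D', ⟨_, hx.stretch fun e h₁ h₂ => (hlen e h₁ h₂).symm⟩,
      stretchDiv_stretchDiv Γ₂ Γ₁ D'⟩

lemma image_cellCoords (hlen : ∀ e, ¬ G.IsLoop e → ¬ G.IsBridge e → Γ₁.len e = Γ₂.len e) :
    stretchCoords Γ₁ Γ₂ _ '' Γ₁.cellCoords (Γ₁.ofVertices D) σ =
      Γ₂.cellCoords (Γ₂.ofVertices D) σ := by
  refine Set.Subset.antisymm ?_ ?_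
  · rintro _ ⟨x, ⟨D', hx⟩, rfl⟩
    exact ⟨_, hx.stretch hlen⟩
  · rintro x ⟨D', hx⟩
    exact ⟨stretchCoords Γ₂ Γ₁ _ x, ⟨_, hx.stretch fun e h₁ h₂ => (hlen e h₁ h₂).symm⟩,
      (stretchCoords Γ₁ Γ₂ _).right_inv x⟩

end TropicalCurve

end

/-- The combinatorial structure of `|D|`, for `D` supported on vertices, is the same for any two
tropical curves with the same model that differ only in the lengths of loops and bridges. -/
theorem mainTheorem2 {V E : Type*} [Fintype V] [Fintype E] (G : WeightedGraph V E)
    (D : V →₀ ℤ) (Γ₁ Γ₂ : TropicalCurve G)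
    (hlen : ∀ e, ¬ G.IsLoop e → ¬ G.IsBridge e → Γ₁.len e = Γ₂.len e) :
    Γ₁.combinatorialStructure (Γ₁.ofVertices D) =
      Γ₂.combinatorialStructure (Γ₂.ofVertices D) := by
  have hcell := fun σ => TropicalCurve.image_cell D σ hlen
  ext1
  · ext σ
    change (Γ₁.cell _ σ).Nonempty ↔ (Γ₂.cell _ σ).Nonempty
    rw [← hcell, Set.image_nonempty]
  · funext τ σ
    change (_ ∧ _ ∧ _) = (_ ∧ _ ∧ _)
    rw [← hcell, ← hcell, Set.image_nonempty, Set.image_nonempty, ← Homeomorph.image_closure,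
      Set.image_subset_image_iff (Homeomorph.injective _)]
  · funext σ
    change Module.finrank ℝ (vectorSpan ℝ _) = Module.finrank ℝ (vectorSpan ℝ _)
    rw [← TropicalCurve.image_cellCoords D σ hlen]
    let L := TropicalCurve.stretchCoords Γ₁ Γ₂ fun e => Fin (σ.comp e).length
    have := AffineMap.map_vectorSpan L.toLinearMap.toAffineMap
      (s := Γ₁.cellCoords (Γ₁.ofVertices D) σ)
    exact (L.finrank_map_eq _).symm.trans
      (congrArg (fun S : Submodule ℝ _ => Module.finrank ℝ S) this)
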